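/- **Theorem (Multi-Agent Q-Learning Convergence).** Let $S$ be a finite state set, $A$ and $B$ nonempty finite action sets of an attacker and a defender, $P(\cdot\mid s,a,b)$ a transition kernel on $S$, $r:S\times A\times B\to\mathbb R$ a reward function (the resilience score, which the attacker minimizes and the defender maximizes), and $\gamma\in[0,1)$ a discount factor. For matrices $U,V\in\mathbb R^{A\times B}$, a *Nash equilibrium of the stage game* $(U,V)$ is a pair of mixed strategies $(x,y)\in\Delta_A\times\Delta_B$ with $x^TUy\le x'^TUy$ for all $x'\in\Delta_A$ and $x^TVy'\le x^TVy$ for all $y'\in\Delta_B$. A pair $(Q^{att},Q^{def})$ of functions $S\times A\times B\to\mathbb R$ is a *Nash-Q equilibrium* if there are mixed strategies $(x_s,y_s)_{s\in S}$ such that, for every $s$, $(x_s,y_s)$ is a Nash equilibrium of the stage game $(Q^{att}(s,\cdot,\cdot),Q^{def}(s,\cdot,\cdot))$, and $Q(s,a,b)=r(s,a,b)+\gamma\sum_{s'}P(s'\mid s,a,b)\,x_{s'}^TQ(s',\cdot,\cdot)\,y_{s'}$ for all $(s,a,b)$ and for both $Q=Q^{att}$ and $Q=Q^{def}$. Let $(\alpha^{att}_t)$,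 $(\alpha^{def}_t)$ be nonnegative learning rates that satisfy the Robbins–Monro conditions $\sum_t\alpha_t=\infty$, $\sum_t\alpha_t^2<\infty$. Let $(Q^{att}_t,Q^{def}_t)$ start from arbitrary deterministic tables and be updated synchronously: at each step $t$, for every $(s,a,b)$, a next state $s'=\xi_t(s,a,b)$ is drawn which, given the past $\mathcal F_t$, has law $P(\cdot\mid s,a,b)$, and both agents update all entries by $$Q^{i}_{t+1}(s,a,b)=Q^{i}_t(s,a,b)+\alpha^{i}_t\Big[r(s,a,b)+\gamma\,(x^{i}_{t,s'})^TQ^{i}_t(s',\cdot,\cdot)\,y^{i}_{t,s'}-Q^{i}_t(s,a,b)\Big],\qquad i\in\{att,def\},$$ where $(x^{i}_{t,s},y^{i}_{t,s})_{s\in S}$ are the $\mathcal F_t$-measurable strategies with which agent $i$ evaluates the stage games at time $t$. Then there is exactly one Nash-Q equilibrium $(Q^{*att},Q^{*def})$, and $$\lim_{t\to\infty}(Q^{att}_t,Q^{def}_t)=(Q^{*att},Q^{*def})\quad\text{almost surely}$$ in each of the following two cases: 1. each agent plays the equilibrium of the stage games given by its own current Q-estimate: almost surely, for $i\in\{att,def\}$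 and all $t$ and $s$, $(x^{i}_{t,s},y^{i}_{t,s})$ is the unique Nash equilibrium of the stage game $(Q^{i}_t(s,\cdot,\cdot),Q^{i}_t(s,\cdot,\cdot))$; 2. the agents play the joint equilibrium of the stage games given by both current Q-estimates: $(x^{att}_{t,s},y^{att}_{t,s})=(x^{def}_{t,s},y^{def}_{t,s})$ is, almost surely for all $t$ and $s$, the unique Nash equilibrium of the stage game $(Q^{att}_t(s,\cdot,\cdot),Q^{def}_t(s,\cdot,\cdot))$, and the learning rates are asymptotically equivalent, $\alpha^{att}_t-\alpha^{def}_t=o(\alpha^{def}_t)$ (for example equal). -/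

import Mathlib

open MeasureTheory ProbabilityTheory Filter Topology Asymptotics

/-- A finite discounted attacker/defender Markov game: `A` is the attacker's action set, `B` the
defender's, `r` the common reward (the resilience score), which the attacker minimizes and the
defender maximizes. -/
structure MarkovGame (S A B : Type*) [Fintype S] where
  P : S → A → B → S → ℝ
  P_nonneg : ∀ s a b s', 0 ≤ P s a b s'
  P_sum : ∀ s a b, ∑ s', P s a b s' = 1
  r : S → A → B → ℝ
  γ : ℝ
  γ_nonneg : 0 ≤ γ
  γ_lt_one : γ < 1

/-- A pair of mixed strategies, the attacker's and the defender's. -/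
abbrev StrategyPair (A B : Type*) := (A → ℝ) × (B → ℝ)

/-- A Q-table `Q s a b`, with `a` the attacker's and `b` the defender's action. -/
abbrev QTable (S A B : Type*) := S → A → B → ℝ

/-- Expected payoff of the matrix `U` under a pair of mixed strategies. -/
def stagePayoff {A B : Type*} [Fintype A] [Fintype B] (U : A → B → ℝ) (x : StrategyPair A B) : ℝ :=
  ∑ a, ∑ b, x.1 a * U a b * x.2 b

/-- Nash equilibrium in mixed strategies of the stage game in which the attacker minimizes `U` and
the defender maximizes `V`. -/
def IsStageNash {A B : Type*} [Fintype A] [Fintype B] (U V : A → B → ℝ)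
    (x : StrategyPair A B) : Prop :=
  x.1 ∈ stdSimplex ℝ A ∧ x.2 ∈ stdSimplex ℝ B ∧
    (∀ p ∈ stdSimplex ℝ A, stagePayoff U x ≤ stagePayoff U (p, x.2)) ∧
    (∀ q ∈ stdSimplex ℝ B, stagePayoff V (x.1, q) ≤ stagePayoff V x)

/-- `r(s,a,b) + γ ∑_{s'} P(s'|s,a,b) v(s')`, where `v(s')` is the expected value of `Q s'` under the
strategies `σ s'`. -/
def bellman {S A B : Type*} [Fintype S] [Fintype A] [Fintype B] (G : MarkovGame S A B)
    (σ : S → StrategyPair A B) (Q : QTable S A B) : QTable S A B :=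
  fun s a b => G.r s a b + G.γ * ∑ s', G.P s a b s' * stagePayoff (Q s') (σ s')

/-- A Nash-Q equilibrium `(Q.1, Q.2)` (attacker's, defender's Q-function): some strategies are, in
each state, a Nash equilibrium of the stage game with costs `Q.1 s` and rewards `Q.2 s`, and
`Q.1`, `Q.2` are the Q-functions of these strategies. -/
def IsNashQEquilibrium {S A B : Type*} [Fintype S] [Fintype A] [Fintype B] (G : MarkovGame S A B)
    (Q : QTable S A B × QTable S A B) : Prop :=
  ∃ σ : S → StrategyPair A B, (∀ s, IsStageNash (Q.1 s) (Q.2 s) (σ s)) ∧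
    Q.1 = bellman G σ Q.1 ∧ Q.2 = bellman G σ Q.2

/-- The Robbins–Monro conditions. -/
def RobbinsMonro (α : ℕ → ℝ) : Prop :=
  (∀ t, 0 ≤ α t) ∧ ¬ Summable α ∧ Summable fun t => α t ^ 2

/-- The temporal-difference error at the entry `(s, a, b)` when the next state is `s'` and the
continuation is evaluated with the strategies `σ`. -/
def tdError {S A B : Type*} [Fintype S] [Fintype A] [Fintype B] (G : MarkovGame S A B)
    (σ : S → StrategyPair A B) (Q : QTable S A B) (s : S) (a : A) (b : B) (s' : S) : ℝ :=
  G.r s a b + G.γ * stagePayoff (Q s') (σ s') - Q s a b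

/-- Synchronous two-agent Q-learning. At step `t` a next state `ξ t ω s a b`, with law
`P(· | s, a, b)` given the past `ℱ t`, is drawn for each entry, and both agents update all entries
of their tables; `σatt`, `σdef` are the strategy pairs with which the attacker and the defender
evaluate the next state. -/
structure IsQLearning {S A B : Type*} [Fintype S] [Fintype A] [Fintype B] (G : MarkovGame S A B)
    {Ω : Type*} {m : MeasurableSpace Ω} (μ : Measure Ω) (ℱ : Filtration ℕ m)
    (ξ : ℕ → Ω → S → A → B → S) (αatt αdef : ℕ → ℝ)
    (σatt σdef : ℕ → Ω → S → StrategyPair A B)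
    (Qatt Qdef : ℕ → Ω → QTable S A B) : Prop where
  initial : ∃ Qatt₀ Qdef₀ : QTable S A B, ∀ ω, Qatt 0 ω = Qatt₀ ∧ Qdef 0 ω = Qdef₀
  adapted_att : ∀ t s, Measurable[ℱ t] fun ω => σatt t ω s
  adapted_def : ∀ t s, Measurable[ℱ t] fun ω => σdef t ω s
  sample_measurable : ∀ t s a b s', MeasurableSet[ℱ (t + 1)] {ω | ξ t ω s a b = s'}
  sample_law : ∀ t s a b s',
    μ[Set.indicator {ω | ξ t ω s a b = s'} (fun _ => (1 : ℝ)) | ℱ t]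
      =ᵐ[μ] fun _ => G.P s a b s'
  update_att : ∀ t ω s a b, Qatt (t + 1) ω s a b =
    Qatt t ω s a b + αatt t * tdError G (σatt t ω) (Qatt t ω) s a b (ξ t ω s a b)
  update_def : ∀ t ω s a b, Qdef (t + 1) ω s a b =
    Qdef t ω s a b + αdef t * tdError G (σdef t ω) (Qdef t ω) s a b (ξ t ω s a b)

/-- Almost surely, at every time and in every state, the stage game in which the attacker minimizes
`U` and the defender maximizes `V` has exactly one Nash equilibrium, and it is the pair `σ`. -/
def PlaysUniqueNash {S A B : Type*} [Fintype A] [Fintype B]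
    {Ω : Type*} {m : MeasurableSpace Ω} (μ : Measure Ω) (U V : ℕ → Ω → QTable S A B)
    (σ : ℕ → Ω → S → StrategyPair A B) : Prop :=
  ∀ᵐ ω ∂μ, ∀ t s, IsStageNash (U t ω s) (V t ω s) (σ t ω s) ∧
    ∀ x, IsStageNash (U t ω s) (V t ω s) x → x = σ t ω s

/-! ### Matrix games: minimax value and its stability -/

section StageGame

variable {A B : Type*} [Fintype A] [Fintype B]

/-! At a Nash-Q equilibrium both Q-functions solve the same affine equation `Q = bellman G σ Q`, a
`γ`-contraction, so they coincide. The stage games are then zero-sum, their payoffs are minimax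
values, and the common table is the unique fixed point of the Shapley operator.

Q-learning is a stochastic approximation of that fixed point: an update moves a table towards
`shapley G Q`, up to a bias (payoff actually used minus minimax value) and a martingale-difference
noise. Tables stay within a deterministic bound, so the weighted noise is an L²-bounded martingale
and its series converges (`ae_exists_tendsto_sum_mul_of_condExp_eq_zero`). Along a path with
convergent noise series and vanishing bias, contraction forces convergence
(`RobbinsMonro.tendsto_of_contraction`).

If each agent uses its own zero-sum stage game, the bias is zero. In the joint case both agents
share samples and strategies, so rewards cancel in `Qatt - Qdef`, and this difference contracts to
zero path by path (`IsQLearning.tendsto_sub`). The stage games thus become asymptotically zero-sum,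
and `IsStageNash.abs_stagePayoff_sub_le` bounds the defender's bias by `2 * ‖Qatt - Qdef‖`. -/

theorem stagePayoff_sub (U V : A → B → ℝ) (x : StrategyPair A B) :
    stagePayoff (U - V) x = stagePayoff U x - stagePayoff V x := by
  simp [stagePayoff, mul_sub, sub_mul, Finset.sum_sub_distrib]

theorem abs_stagePayoff_le (U : A → B → ℝ) {x : StrategyPair A B} (h1 : x.1 ∈ stdSimplex ℝ A)
    (h2 : x.2 ∈ stdSimplex ℝ B) : |stagePayoff U x| ≤ ‖U‖ := by
  calc |stagePayoff U x| ≤ ∑ a, ∑ b, x.1 a * ‖U‖ * x.2 b := by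
        refine (Finset.abs_sum_le_sum_abs _ _).trans (Finset.sum_le_sum fun a _ =>
          (Finset.abs_sum_le_sum_abs _ _).trans (Finset.sum_le_sum fun b _ => ?_))
        rw [abs_mul, abs_mul, abs_of_nonneg (h1.1 a), abs_of_nonneg (h2.1 b)]
        have h3 : |U a b| ≤ ‖U‖ := (norm_le_pi_norm (U a) b).trans (norm_le_pi_norm U a)
        have := h1.1 a
        have := h2.1 b
        gcongr
    _ = ‖U‖ := by
        simp_rw [← Finset.mul_sum, h2.2, ← Finset.sum_mul, h1.2]
        ring

theorem abs_stagePayoff_sub_le (U V : A → B → ℝ) {x : StrategyPair A B}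
    (h1 : x.1 ∈ stdSimplex ℝ A) (h2 : x.2 ∈ stdSimplex ℝ B) :
    |stagePayoff U x - stagePayoff V x| ≤ ‖U - V‖ := by
  rw [← stagePayoff_sub]
  exact abs_stagePayoff_le _ h1 h2

/-- The payoff of a Nash equilibrium of an almost zero-sum game is close to the payoff of a Nash
equilibrium of a nearby zero-sum game. -/
theorem IsStageNash.abs_stagePayoff_sub_le {U V W : A → B → ℝ} {x y : StrategyPair A B}
    (hx : IsStageNash U V x) (hy : IsStageNash W W y) :
    |stagePayoff V x - stagePayoff W y| ≤ 2 * ‖U - V‖ + ‖V - W‖ := by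
  obtain ⟨x1, x2, x3, x4⟩ := hx
  obtain ⟨y1, y2, y3, y4⟩ := hy
  -- Upper bound: pass from `V` to `U` at `x`, let the attacker deviate to `y.1`, return to `V`,
  -- pass to `W`, then use that `y.2` is optimal against `y.1`. This uses `‖U - V‖` twice. The lower
  -- bound goes through `(x.1, y.2)` and needs only `‖V - W‖`.
  have a1 := abs_le.1 (_root_.abs_stagePayoff_sub_le U V x1 x2)
  have a2 := abs_le.1 (_root_.abs_stagePayoff_sub_le U V (x := (y.1, x.2)) y1 x2)
  have a3 := abs_le.1 (_root_.abs_stagePayoff_sub_le V W (x := (y.1, x.2)) y1 x2)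
  have a4 := abs_le.1 (_root_.abs_stagePayoff_sub_le V W (x := (x.1, y.2)) x1 y2)
  have b1 := x3 _ y1
  have b2 := x4 _ y2
  have b3 := y3 _ x1
  have b4 := y4 _ x2
  have := norm_nonneg (U - V)
  rw [abs_le]
  constructor <;> linarith

/-- **Minimax theorem** for matrix games. -/
theorem exists_isStageNash [Nonempty A] [Nonempty B] (U : A → B → ℝ) :
    ∃ x, IsStageNash U U x := by
  classical
  have c1 : ∀ p : A → ℝ, Continuous fun q : B → ℝ => stagePayoff U (p, q) := fun p => by
    unfold stagePayoff; fun_prop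
  have c2 : ∀ q : B → ℝ, Continuous fun p : A → ℝ => stagePayoff U (p, q) := fun q => by
    unfold stagePayoff; fun_prop
  have l1 : ∀ p : A → ℝ, IsLinearMap ℝ fun q : B → ℝ => stagePayoff U (p, q) := fun p => by
    constructor
    · intro y z
      simp [stagePayoff, mul_add, Finset.sum_add_distrib]
    · intro c y
      simp only [stagePayoff, Pi.smul_apply, smul_eq_mul, Finset.mul_sum]
      exact Finset.sum_congr rfl fun a _ => Finset.sum_congr rfl fun b _ => by ring
  have l2 : ∀ q : B → ℝ, IsLinearMap ℝ fun p : A → ℝ => stagePayoff U (p, q) := fun q => by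
    constructor
    · intro y z
      simp [stagePayoff, add_mul, Finset.sum_add_distrib]
    · intro c y
      simp only [stagePayoff, Pi.smul_apply, smul_eq_mul, Finset.mul_sum]
      exact Finset.sum_congr rfl fun a _ => Finset.sum_congr rfl fun b _ => by ring
  obtain ⟨a, ha, b, hb, hab⟩ := Sion.exists_isSaddlePointOn
    (X := stdSimplex ℝ A) (Y := stdSimplex ℝ B) (f := fun p q => stagePayoff U (p, q))
    (ne_X := ⟨_, single_mem_stdSimplex ℝ (Classical.arbitrary A)⟩)
    (cX := convex_stdSimplex ℝ A) (kX := isCompact_stdSimplex ℝ A)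
    (hfy := fun q _ => (c2 q).continuousOn.lowerSemicontinuousOn)
    (hfy' := fun q _ => (((l2 q).mk' _).convexOn (convex_stdSimplex ℝ A)).quasiconvexOn)
    (cY := convex_stdSimplex ℝ B)
    (ne_Y := ⟨_, single_mem_stdSimplex ℝ (Classical.arbitrary B)⟩)
    (kY := isCompact_stdSimplex ℝ B)
    (hfx := fun p _ => (c1 p).continuousOn.upperSemicontinuousOn)
    (hfx' := fun p _ => (((l1 p).mk' _).concaveOn (convex_stdSimplex ℝ B)).quasiconcaveOn)
  exact ⟨(a, b), ha, hb, fun p hp => hab p hp b hb, fun q hq => hab a ha q hq⟩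

variable [Nonempty A] [Nonempty B]

/-- The minimax value of a matrix game. -/
noncomputable def stageValue (U : A → B → ℝ) : ℝ := stagePayoff U (exists_isStageNash U).choose

theorem IsStageNash.abs_stagePayoff_sub_stageValue_le {U V : A → B → ℝ} {x : StrategyPair A B}
    (hx : IsStageNash U V x) (W : A → B → ℝ) :
    |stagePayoff V x - stageValue W| ≤ 2 * ‖U - V‖ + ‖V - W‖ :=
  hx.abs_stagePayoff_sub_le (exists_isStageNash W).choose_spec

/-- Makes the value independent of the equilibrium chosen in `stageValue`: for equal matrices the
error bound is zero. -/
theorem IsStageNash.stagePayoff_eq {U : A → B → ℝ} {x : StrategyPair A B}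
    (hx : IsStageNash U U x) : stagePayoff U x = stageValue U := by
  have := hx.abs_stagePayoff_sub_stageValue_le U
  simpa [sub_eq_zero] using this

theorem abs_stageValue_sub_le (U V : A → B → ℝ) : |stageValue U - stageValue V| ≤ ‖U - V‖ := by
  have := (exists_isStageNash U).choose_spec.abs_stagePayoff_sub_stageValue_le V
  rwa [sub_self, norm_zero, mul_zero, zero_add] at this

end StageGame

/-! ### The Shapley operator and uniqueness of the Nash-Q equilibrium -/

section Shapley

variable {S A B : Type*} [Fintype S] [Fintype A] [Fintype B]

theorem norm_qTable_le {Q : QTable S A B} {c : ℝ} (hc : 0 ≤ c) (h : ∀ s a b, |Q s a b| ≤ c) :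
    ‖Q‖ ≤ c :=
  (pi_norm_le_iff_of_nonneg hc).2 fun s => (pi_norm_le_iff_of_nonneg hc).2 fun a =>
    (pi_norm_le_iff_of_nonneg hc).2 fun b => h s a b

theorem abs_qTable_apply_le (Q : QTable S A B) (s : S) (a : A) (b : B) : |Q s a b| ≤ ‖Q‖ :=
  ((norm_le_pi_norm (Q s a) b).trans (norm_le_pi_norm (Q s) a)).trans (norm_le_pi_norm Q s)

omit [Fintype A] [Fintype B] in
theorem MarkovGame.abs_discounted_sum_le (G : MarkovGame S A B) {v : S → ℝ} {c : ℝ}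
    (h : ∀ s, |v s| ≤ c) (s : S) (a : A) (b : B) :
    |G.γ * ∑ s', G.P s a b s' * v s'| ≤ G.γ * c := by
  rw [abs_mul, abs_of_nonneg G.γ_nonneg]
  refine mul_le_mul_of_nonneg_left ?_ G.γ_nonneg
  calc _ ≤ ∑ s', G.P s a b s' * c := by
        refine (Finset.abs_sum_le_sum_abs _ _).trans (Finset.sum_le_sum fun s' _ => ?_)
        rw [abs_mul, abs_of_nonneg (G.P_nonneg s a b s')]
        exact mul_le_mul_of_nonneg_left (h s') (G.P_nonneg s a b s')
    _ = c := by rw [← Finset.sum_mul, G.P_sum, one_mul]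

theorem norm_bellman_sub_le (G : MarkovGame S A B) {σ : S → StrategyPair A B}
    (hσ : ∀ s, (σ s).1 ∈ stdSimplex ℝ A ∧ (σ s).2 ∈ stdSimplex ℝ B) (Q Q' : QTable S A B) :
    ‖bellman G σ Q - bellman G σ Q'‖ ≤ G.γ * ‖Q - Q'‖ := by
  refine norm_qTable_le (mul_nonneg G.γ_nonneg (norm_nonneg _)) fun s a b => ?_
  have := G.abs_discounted_sum_le (v := fun s' => stagePayoff (Q s') (σ s') -
    stagePayoff (Q' s') (σ s')) (c := ‖Q - Q'‖) (fun s' =>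
      (abs_stagePayoff_sub_le _ _ (hσ s').1 (hσ s').2).trans (norm_le_pi_norm (Q - Q') s')) s a b
  simpa [bellman, mul_sub, Finset.sum_sub_distrib] using this

variable [Nonempty A] [Nonempty B]

/-- The Shapley operator. -/
noncomputable def shapley (G : MarkovGame S A B) (Q : QTable S A B) : QTable S A B :=
  fun s a b => G.r s a b + G.γ * ∑ s', G.P s a b s' * stageValue (Q s')

theorem norm_shapley_sub_le (G : MarkovGame S A B) (Q Q' : QTable S A B) :
    ‖shapley G Q - shapley G Q'‖ ≤ G.γ * ‖Q - Q'‖ := by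
  refine norm_qTable_le (mul_nonneg G.γ_nonneg (norm_nonneg _)) fun s a b => ?_
  have := G.abs_discounted_sum_le (v := fun s' => stageValue (Q s') - stageValue (Q' s'))
    (c := ‖Q - Q'‖) (fun s' =>
      (abs_stageValue_sub_le _ _).trans (norm_le_pi_norm (Q - Q') s')) s a b
  simpa [shapley, mul_sub, Finset.sum_sub_distrib] using this

theorem contractingWith_shapley (G : MarkovGame S A B) :
    ContractingWith ⟨G.γ, G.γ_nonneg⟩ (shapley G) :=
  ⟨by exact_mod_cast G.γ_lt_one, LipschitzWith.of_dist_le_mul fun Q Q' => by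
    rw [dist_eq_norm, dist_eq_norm]
    exact norm_shapley_sub_le G Q Q'⟩

/-- The minimax Q-function of the game. -/
noncomputable def shapleyQ (G : MarkovGame S A B) : QTable S A B :=
  (contractingWith_shapley G).fixedPoint (shapley G)

theorem shapley_shapleyQ (G : MarkovGame S A B) : shapley G (shapleyQ G) = shapleyQ G :=
  (contractingWith_shapley G).fixedPoint_isFixedPt

theorem bellman_eq_shapley (G : MarkovGame S A B) {σ : S → StrategyPair A B} {Q : QTable S A B}
    (h : ∀ s, IsStageNash (Q s) (Q s) (σ s)) : bellman G σ Q = shapley G Q := by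
  funext s a b
  simp only [bellman, shapley, (h _).stagePayoff_eq]

theorem isNashQEquilibrium_iff (G : MarkovGame S A B) (Q : QTable S A B × QTable S A B) :
    IsNashQEquilibrium G Q ↔ Q = (shapleyQ G, shapleyQ G) := by
  constructor
  · rintro ⟨σ, hσ, h1, h2⟩
    -- Both tables are fixed by the same contraction `bellman G σ`; hence the stage games are
    -- zero-sum.
    have h12 : Q.1 = Q.2 := by
      have h := norm_bellman_sub_le G (fun s => ⟨(hσ s).1, (hσ s).2.1⟩) Q.1 Q.2
      rw [← h1, ← h2] at h
      have h0 : ‖Q.1 - Q.2‖ ≤ 0 := by nlinarith [norm_nonneg (Q.1 - Q.2), G.γ_lt_one]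
      exact sub_eq_zero.1 (norm_le_zero_iff.1 h0)
    have h3 : Q.2 = shapleyQ G := by
      refine (contractingWith_shapley G).fixedPoint_unique ?_
      exact (bellman_eq_shapley G fun s => by simpa [h12] using hσ s).symm.trans h2.symm
    exact Prod.ext (h12.trans h3) h3
  · rintro rfl
    have hσ := fun s => (exists_isStageNash (shapleyQ G s)).choose_spec
    have h := (bellman_eq_shapley G hσ).trans (shapley_shapleyQ G)
    exact ⟨_, hσ, h.symm, h.symm⟩

end Shapley

/-! ### Deterministic recursions with Robbins–Monro rates -/

theorem RobbinsMonro.tendsto_zero {α : ℕ → ℝ} (h : RobbinsMonro α) : Tendsto α atTop (𝓝 0) := by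
  have h2 := h.2.2.tendsto_atTop_zero
  have h3 := h2.sqrt
  simpa [Real.sqrt_sq (h.1 _)] using h3

/-- A nonnegative sequence that is contracted at rate `κ α t` up to errors of smaller order tends
to zero. -/
theorem RobbinsMonro.tendsto_zero_of_recursion {α : ℕ → ℝ} (h : RobbinsMonro α) {κ : ℝ}
    (hκ : 0 < κ) {a ε : ℕ → ℝ} (ha : ∀ t, 0 ≤ a t) (hε : Tendsto ε atTop (𝓝 0))
    (hrec : ∀ᶠ t in atTop, a (t + 1) ≤ (1 - κ * α t) * a t + α t * ε t) :
    Tendsto a atTop (𝓝 0) := by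
  have key : ∀ δ > 0, ∀ᶠ t in atTop, a t < 2 * δ := by
    intro δ hδ
    have h1 : ∀ᶠ t in atTop, κ * α t < 1 := by
      have : Tendsto (fun t => κ * α t) atTop (𝓝 0) := by
        simpa using h.tendsto_zero.const_mul κ
      exact this.eventually_lt_const one_pos
    have h2 : ∀ᶠ t in atTop, ε t < κ * δ := hε.eventually_lt_const (by positivity)
    obtain ⟨T, hT⟩ := eventually_atTop.1 (hrec.and (h1.and h2))
    -- Once `ε t < κ * δ`, the error is absorbed by the contraction towards level `δ`, so the excess
    -- over `δ` satisfies a homogeneous recursion.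
    set b : ℕ → ℝ := fun t => max (a t - δ) 0 with hb
    have hb0 : ∀ t, 0 ≤ b t := fun t => le_max_right _ _
    have hstep : ∀ t ≥ T, b (t + 1) ≤ Real.exp (-(κ * α t)) * b t := by
      intro t ht
      obtain ⟨e1, e2, e3⟩ := hT t ht
      have e4 : b (t + 1) ≤ (1 - κ * α t) * b t := by
        refine max_le ?_ (mul_nonneg (by linarith) (hb0 t))
        have e5 : (1 - κ * α t) * (a t - δ) ≤ (1 - κ * α t) * b t :=
          mul_le_mul_of_nonneg_left (le_max_left _ _) (by linarith)
        have e6 := mul_le_mul_of_nonneg_left e3.le (h.1 t)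
        linarith
      refine e4.trans (mul_le_mul_of_nonneg_right ?_ (hb0 t))
      linarith [Real.add_one_le_exp (-(κ * α t))]
    have hbound : ∀ n, b (n + T) ≤
        Real.exp (-(κ * ∑ k ∈ Finset.range n, α (k + T))) * b T := by
      intro n
      induction n with
      | zero => simp
      | succ n ih =>
        rw [Finset.sum_range_succ, mul_add, neg_add, Real.exp_add, Nat.add_right_comm]
        calc b (n + T + 1) ≤ _ := hstep _ (by omega)
          _ ≤ _ := mul_le_mul_of_nonneg_left ih (Real.exp_pos _).le
          _ = _ := by ring
    have hsum : Tendsto (fun n => ∑ k ∈ Finset.range n, α (k + T)) atTop atTop := by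
      refine (not_summable_iff_tendsto_nat_atTop_of_nonneg fun k => h.1 _).1 ?_
      rw [summable_nat_add_iff]
      exact h.2.1
    have hlim : Tendsto (fun n => Real.exp (-(κ * ∑ k ∈ Finset.range n, α (k + T))) * b T)
        atTop (𝓝 0) := by
      have := (Real.tendsto_exp_neg_atTop_nhds_zero.comp (hsum.const_mul_atTop hκ)).mul_const (b T)
      simpa using this
    have hb1 : Tendsto (fun n => b (n + T)) atTop (𝓝 0) :=
      squeeze_zero (fun n => hb0 _) hbound hlim
    filter_upwards [((tendsto_add_atTop_iff_nat T).1 hb1).eventually_lt_const hδ] with t ht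
    have := le_max_left (a t - δ) 0
    simp only [hb] at ht
    linarith
  rw [tendsto_order]
  refine ⟨fun c hc => Eventually.of_forall fun t => hc.trans_le (ha t), fun c hc => ?_⟩
  filter_upwards [key (c / 2) (by linarith)] with t ht
  linarith

/-- Stochastic approximation along one path: the iteration towards the fixed point of a
(pseudo-)contraction converges if the biases vanish and the weighted noise is summable. -/
theorem RobbinsMonro.tendsto_of_contraction {E : Type*} [NormedAddCommGroup E] [NormedSpace ℝ E]
    {α : ℕ → ℝ} (h : RobbinsMonro α) {κ : ℝ} (hκ0 : 0 ≤ κ) (hκ : κ < 1) {T : E → E} {z : E}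
    (hT : ∀ x, ‖T x - z‖ ≤ κ * ‖x - z‖) {x e w : ℕ → E}
    (hx : ∀ t, x (t + 1) = x t + α t • (T (x t) - x t + e t + w t))
    (he : Tendsto e atTop (𝓝 0)) {l : E}
    (hw : Tendsto (fun n => ∑ t ∈ Finset.range n, α t • w t) atTop (𝓝 l)) :
    Tendsto x atTop (𝓝 z) := by
  -- Tail of the noise series. Adding it to `x t - z` cancels the noise exactly, leaving a recursion
  -- with vanishing perturbations only.
  set R : ℕ → E := fun n => l - ∑ t ∈ Finset.range n, α t • w t with hR
  have hR0 : Tendsto R atTop (𝓝 0) := by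
    simpa using (tendsto_const_nhds (x := l)).sub hw
  have hstep : ∀ t, x (t + 1) - z + R (t + 1) =
      (1 - α t) • (x t - z + R t) + α t • (T (x t) - z + e t + R t) := by
    intro t
    simp only [hR, hx, Finset.sum_range_succ]
    module
  have hε : Tendsto (fun t => (1 + κ) * ‖R t‖ + ‖e t‖) atTop (𝓝 0) := by
    simpa using (hR0.norm.const_mul (1 + κ)).add he.norm
  have hmain : Tendsto (fun t => ‖x t - z + R t‖) atTop (𝓝 0) := by
    refine h.tendsto_zero_of_recursion (sub_pos.2 hκ) (fun t => norm_nonneg _) hε ?_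
    filter_upwards [h.tendsto_zero.eventually_lt_const one_pos] with t ht
    rw [hstep]
    have h1 : ‖x t - z‖ ≤ ‖x t - z + R t‖ + ‖R t‖ := by
      simpa using norm_sub_le (x t - z + R t) (R t)
    have h2 : ‖T (x t) - z + e t + R t‖ ≤
        κ * (‖x t - z + R t‖ + ‖R t‖) + ‖e t‖ + ‖R t‖ :=
      (norm_add₃_le).trans (by grw [hT, h1])
    calc _ ≤ ‖(1 - α t) • (x t - z + R t)‖ + ‖α t • (T (x t) - z + e t + R t)‖ := norm_add_le _ _
      _ = (1 - α t) * ‖x t - z + R t‖ + α t * ‖T (x t) - z + e t + R t‖ := by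
        rw [norm_smul, norm_smul, Real.norm_of_nonneg (h.1 t), Real.norm_of_nonneg (by linarith)]
      _ ≤ (1 - α t) * ‖x t - z + R t‖ +
          α t * (κ * (‖x t - z + R t‖ + ‖R t‖) + ‖e t‖ + ‖R t‖) := by
        have := h.1 t
        gcongr
      _ = _ := by ring
  have := ((tendsto_zero_iff_norm_tendsto_zero.2 hmain).sub hR0).add_const z
  simpa using this

/-- The iterates of `c ↦ |1 - α t| c + α t (R + γ c)` are bounded. -/
theorem RobbinsMonro.exists_bound {α : ℕ → ℝ} (h : RobbinsMonro α) {γ R : ℝ} (hγ0 : 0 ≤ γ)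
    (hγ : γ < 1) {c : ℕ → ℝ}
    (hc : ∀ t, c (t + 1) = |1 - α t| * c t + α t * (R + γ * c t)) : ∃ C, ∀ t, c t ≤ C := by
  obtain ⟨T, hT⟩ := eventually_atTop.1 (h.tendsto_zero.eventually_lt_const one_pos)
  have hg : 0 < 1 - γ := by linarith
  -- Once `α t < 1`, the new value is a convex combination of `c t` and `R + γ * c t`; any level at
  -- least `R / (1 - γ)` is preserved.
  set K := max (c T) (R / (1 - γ)) with hK
  have hRK : R ≤ (1 - γ) * K := by
    have := le_max_right (c T) (R / (1 - γ))
    rw [div_le_iff₀ hg] at this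
    linarith
  have hb : ∀ t ≥ T, c t ≤ K := by
    intro t ht
    induction t, ht using Nat.le_induction with
    | base => exact le_max_left _ _
    | succ t ht ih =>
      have h1 := h.1 t
      have h2 := hT t ht
      rw [hc, abs_of_pos (by linarith)]
      calc _ ≤ (1 - α t) * K + α t * ((1 - γ) * K + γ * K) := by gcongr
        _ = K := by ring
  have hbdd : IsBoundedUnder (· ≤ ·) atTop c := ⟨K, eventually_map.2 (eventually_atTop.2 ⟨T, hb⟩)⟩
  obtain ⟨C, hC⟩ := hbdd.bddAbove_range
  exact ⟨C, fun t => hC ⟨t, rfl⟩⟩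

/-! ### Almost sure convergence of the weighted noise -/

section Noise

variable {Ω : Type*} {m : MeasurableSpace Ω} {μ : Measure Ω} [IsProbabilityMeasure μ]
  {ℱ : Filtration ℕ m}

/-- A series of bounded martingale differences with square-summable weights converges. -/
theorem ae_exists_tendsto_sum_mul_of_condExp_eq_zero {α : ℕ → ℝ}
    (hα : Summable fun t => α t ^ 2) {d : ℕ → Ω → ℝ} {C : ℝ}
    (hd : ∀ t, StronglyMeasurable[ℱ (t + 1)] (d t)) (hC : ∀ t ω, |d t ω| ≤ C)
    (h0 : ∀ t, μ[d t | ℱ t] =ᵐ[μ] 0) :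
    ∀ᵐ ω ∂μ, ∃ l, Tendsto (fun n => ∑ t ∈ Finset.range n, α t * d t ω) atTop (𝓝 l) := by
  set M : ℕ → Ω → ℝ := fun n ω => ∑ t ∈ Finset.range n, α t * d t ω with hM
  have hMm : ∀ n, StronglyMeasurable[ℱ n] (M n) := fun n => by
    refine Finset.stronglyMeasurable_fun_sum _ fun t ht => ?_
    exact ((hd t).mono (ℱ.mono (Finset.mem_range.1 ht))).const_mul (α t)
  have hMb : ∀ n ω, ‖M n ω‖ ≤ ∑ t ∈ Finset.range n, |α t| * C := fun n ω =>
    (Finset.abs_sum_le_sum_abs _ _).trans (Finset.sum_le_sum fun t _ => by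
      rw [abs_mul]
      exact mul_le_mul_of_nonneg_left (hC t ω) (abs_nonneg _))
  have hMs : ∀ n, AEStronglyMeasurable (M n) μ := fun n =>
    ((hMm n).mono (ℱ.le n)).aestronglyMeasurable
  have hds : ∀ n, AEStronglyMeasurable (d n) μ := fun n =>
    ((hd n).mono (ℱ.le _)).aestronglyMeasurable
  have hMi : ∀ n, Integrable (M n) μ := fun n => .of_bound (hMs n) _ (.of_forall (hMb n))
  have hdi : ∀ n, Integrable (d n) μ := fun n => .of_bound (hds n) C (.of_forall (hC n))
  have hMdi : ∀ n, Integrable (M n * d n) μ := fun n =>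
    (hdi n).bdd_mul (hMs n) (.of_forall (hMb n))
  have hM2i : ∀ n, Integrable (fun ω => M n ω ^ 2) μ := fun n => by
    simpa only [sq] using! (hMi n).bdd_mul (hMs n) (.of_forall (hMb n))
  have hd2i : ∀ n, Integrable (fun ω => d n ω ^ 2) μ := fun n => by
    simpa only [sq] using! (hdi n).bdd_mul (hds n) (.of_forall (hC n))
  have hsucc : ∀ n ω, M (n + 1) ω = M n ω + α n * d n ω := fun n ω =>
    Finset.sum_range_succ _ _
  have hmart : Martingale M ℱ μ := by
    refine martingale_of_condExp_sub_eq_zero_nat hMm hMi fun n => ?_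
    have h1 : M (n + 1) - M n = α n • d n := by
      funext ω
      simp [hsucc]
    rw [h1]
    filter_upwards [condExp_smul (μ := μ) (α n) (d n) (ℱ n), h0 n] with ω h2 h3
    rw [h2, Pi.smul_apply, h3]
    simp
  -- The increment is orthogonal to the past, so second moments add up with weights `α t ^ 2`.
  have horth : ∀ n, ∫ ω, (M n * d n) ω ∂μ = 0 := fun n => by
    rw [← integral_condExp (ℱ.le n)]
    refine integral_eq_zero_of_ae ?_
    filter_upwards [condExp_mul_of_stronglyMeasurable_left (hMm n) (hMdi n) (hdi n), h0 n]
      with ω h2 h3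
    rw [h2, Pi.mul_apply, h3]
    simp
  have hsq : ∀ n, ∫ ω, M n ω ^ 2 ∂μ ≤ C ^ 2 * ∑ t ∈ Finset.range n, α t ^ 2 := fun n => by
    induction n with
    | zero => simp [hM]
    | succ n ih =>
      have h1 : ∀ ω, M (n + 1) ω ^ 2 =
          M n ω ^ 2 + (2 * α n) * (M n * d n) ω + α n ^ 2 * d n ω ^ 2 := fun ω => by
        rw [hsucc, Pi.mul_apply]
        ring
      have h2 : ∫ ω, d n ω ^ 2 ∂μ ≤ C ^ 2 := by
        calc _ ≤ ∫ _, C ^ 2 ∂μ := integral_mono (hd2i n) (integrable_const _) fun ω =>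
              sq_le_sq.2 ((hC n ω).trans (le_abs_self C))
          _ = C ^ 2 := by simp
      simp_rw [h1]
      rw [integral_add (f := fun ω => M n ω ^ 2 + (2 * α n) * (M n * d n) ω)
          ((hM2i n).add ((hMdi n).const_mul _)) ((hd2i n).const_mul _),
        integral_add (hM2i n) ((hMdi n).const_mul _), integral_const_mul, integral_const_mul,
        horth, Finset.sum_range_succ]
      nlinarith [mul_le_mul_of_nonneg_left h2 (sq_nonneg (α n))]
  refine hmart.submartingale.exists_ae_tendsto_of_bdd
    (R := (1 + C ^ 2 * ∑' t, α t ^ 2).toNNReal) fun n => ?_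
  rw [eLpNorm_one_eq_lintegral_enorm, ← ofReal_integral_norm_eq_lintegral_enorm (hMi n)]
  refine ENNReal.ofReal_le_ofReal ?_
  -- The L² bound gives the L¹ bound needed for martingale convergence via `|x| ≤ 1 + x ^ 2`.
  calc ∫ ω, ‖M n ω‖ ∂μ ≤ ∫ ω, (1 + M n ω ^ 2) ∂μ :=
        integral_mono (hMi n).norm ((integrable_const 1).add (hM2i n)) fun ω => by
          simp only [Real.norm_eq_abs]
          nlinarith [sq_abs (M n ω), sq_nonneg (|M n ω| - 1)]
    _ = 1 + ∫ ω, M n ω ^ 2 ∂μ := by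
        rw [integral_add (integrable_const 1) (hM2i n)]
        simp
    _ ≤ 1 + C ^ 2 * ∑' t, α t ^ 2 := by
        have h1 := hα.sum_le_tsum (Finset.range n) fun t _ => sq_nonneg (α t)
        have h2 := hsq n
        have h3 := mul_le_mul_of_nonneg_left h1 (sq_nonneg C)
        linarith

/-- The sampling noise of events with constant conditional probabilities, weighted by bounded
predictable coefficients and square-summable rates, is summable. -/
theorem ae_exists_tendsto_sum_mul_indicator_sub {α : ℕ → ℝ} (hα : Summable fun t => α t ^ 2)
    {E : ℕ → Set Ω} (hE : ∀ t, MeasurableSet[ℱ (t + 1)] (E t)) {p : ℝ}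
    (hp : ∀ t, μ[(E t).indicator (fun _ => (1 : ℝ)) | ℱ t] =ᵐ[μ] fun _ => p)
    {v : ℕ → Ω → ℝ} (hv : ∀ t, Measurable[ℱ t] (v t)) {C : ℝ} (hC0 : 0 ≤ C)
    (hC : ∀ᵐ ω ∂μ, ∀ t, |v t ω| ≤ C) :
    ∀ᵐ ω ∂μ, ∃ l, Tendsto (fun n => ∑ t ∈ Finset.range n,
      α t * (v t ω * ((E t).indicator (fun _ => (1 : ℝ)) ω - p))) atTop (𝓝 l) := by
  -- Clipping turns the almost sure bound on `v` into one valid everywhere and keeps predictability;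
  -- almost surely nothing changes.
  set c : ℕ → Ω → ℝ := fun t ω => max (-C) (min C (v t ω)) with hc
  set f : ℕ → Ω → ℝ := fun t ω => (E t).indicator (fun _ => (1 : ℝ)) ω - p with hf
  have hcm : ∀ t, StronglyMeasurable[ℱ t] (c t) := fun t =>
    (Measurable.max measurable_const (Measurable.min measurable_const (hv t))).stronglyMeasurable
  have hcb : ∀ t ω, |c t ω| ≤ C := fun t ω =>
    abs_le.2 ⟨le_max_left _ _, max_le (by linarith) (min_le_left _ _)⟩
  have hfm : ∀ t, StronglyMeasurable[ℱ (t + 1)] (f t) := fun t =>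
    ((stronglyMeasurable_const.indicator (hE t)).sub stronglyMeasurable_const)
  have hfb : ∀ t ω, |f t ω| ≤ 1 + |p| := fun t ω => by
    refine (abs_sub _ _).trans (add_le_add_left ?_ _)
    by_cases h : ω ∈ E t <;> simp [h]
  have hfi : ∀ t, Integrable (f t) μ := fun t =>
    .of_bound ((hfm t).mono (ℱ.le _)).aestronglyMeasurable _ (.of_forall (hfb t))
  have hf0 : ∀ t, μ[f t | ℱ t] =ᵐ[μ] 0 := fun t => by
    have hi : Integrable ((E t).indicator fun _ => (1 : ℝ)) μ :=
      (integrable_const 1).indicator (ℱ.le _ _ (hE t))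
    filter_upwards [condExp_sub hi (integrable_const p) (ℱ t), hp t] with ω h1 h2
    have h3 : μ[f t | ℱ t] ω = _ := h1
    rw [h3, Pi.sub_apply, h2, condExp_const (ℱ.le t)]
    simp
  have hmain := ae_exists_tendsto_sum_mul_of_condExp_eq_zero (μ := μ) (ℱ := ℱ) hα
    (d := fun t => c t * f t) (C := C * (1 + |p|))
    (fun t => ((hcm t).mono (ℱ.mono t.le_succ)).mul (hfm t))
    (fun t ω => by
      rw [Pi.mul_apply, abs_mul]
      exact mul_le_mul (hcb t ω) (hfb t ω) (abs_nonneg _) hC0)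
    (fun t => by
      filter_upwards [condExp_stronglyMeasurable_mul_of_bound (ℱ.le t) (hcm t) (hfi t) C
        (.of_forall (hcb t)), hf0 t] with ω h1 h2
      rw [h1, Pi.mul_apply, h2]
      simp)
  filter_upwards [hmain, hC] with ω ⟨l, hl⟩ hω
  refine ⟨l, hl.congr fun n => Finset.sum_congr rfl fun t _ => ?_⟩
  have h1 := abs_le.1 (hω t)
  simp [hc, hf, min_eq_right h1.2, max_eq_right h1.1]

end Noise

/-! ### Convergence of the learning dynamics -/

section Learning

variable {S A B : Type*} [Fintype S] [Fintype A] [Fintype B] {G : MarkovGame S A B}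

/-- Q-learning of a single agent: the part of `IsQLearning` that concerns one of the tables. -/
structure IsAgentQLearning (G : MarkovGame S A B) {Ω : Type*} {m : MeasurableSpace Ω}
    (μ : Measure Ω) (ℱ : Filtration ℕ m) (ξ : ℕ → Ω → S → A → B → S) (α : ℕ → ℝ)
    (σ : ℕ → Ω → S → StrategyPair A B) (Q : ℕ → Ω → QTable S A B) : Prop where
  initial : ∃ Q₀ : QTable S A B, ∀ ω, Q 0 ω = Q₀
  adapted : ∀ t s, Measurable[ℱ t] fun ω => σ t ω s
  sample_measurable : ∀ t s a b s', MeasurableSet[ℱ (t + 1)] {ω | ξ t ω s a b = s'}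
  sample_law : ∀ t s a b s',
    μ[Set.indicator {ω | ξ t ω s a b = s'} (fun _ => (1 : ℝ)) | ℱ t]
      =ᵐ[μ] fun _ => G.P s a b s'
  update : ∀ t ω s a b, Q (t + 1) ω s a b =
    Q t ω s a b + α t * tdError G (σ t ω) (Q t ω) s a b (ξ t ω s a b)

/-- `σ` consists of mixed strategies. -/
def IsMixed (σ : S → StrategyPair A B) : Prop :=
  ∀ s, (σ s).1 ∈ stdSimplex ℝ A ∧ (σ s).2 ∈ stdSimplex ℝ B

variable {Ω : Type*} {m : MeasurableSpace Ω} {μ : Measure Ω} {ℱ : Filtration ℕ m}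
  {ξ : ℕ → Ω → S → A → B → S} {α αatt αdef : ℕ → ℝ}
  {σ σatt σdef : ℕ → Ω → S → StrategyPair A B} {Q Qatt Qdef : ℕ → Ω → QTable S A B}

theorem IsQLearning.attacker (h : IsQLearning G μ ℱ ξ αatt αdef σatt σdef Qatt Qdef) :
    IsAgentQLearning G μ ℱ ξ αatt σatt Qatt where
  initial := h.initial.imp fun _ h => fun ω => (h.choose_spec ω).1
  adapted := h.adapted_att
  sample_measurable := h.sample_measurable
  sample_law := h.sample_law
  update := h.update_att

theorem IsQLearning.defender (h : IsQLearning G μ ℱ ξ αatt αdef σatt σdef Qatt Qdef) :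
    IsAgentQLearning G μ ℱ ξ αdef σdef Qdef where
  initial := h.initial.elim fun _ h => h.imp fun _ h => fun ω => (h ω).2
  adapted := h.adapted_def
  sample_measurable := h.sample_measurable
  sample_law := h.sample_law
  update := h.update_def

theorem abs_stagePayoff_le_norm (Q : QTable S A B) {σ : S → StrategyPair A B} (hσ : IsMixed σ)
    (s : S) : |stagePayoff (Q s) (σ s)| ≤ ‖Q‖ :=
  (abs_stagePayoff_le _ (hσ s).1 (hσ s).2).trans (norm_le_pi_norm Q s)

/-- Splits the error into its conditional mean and centred noise. Indicators of the next state make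
the noise a finite sum of predictable coefficients times centred events, so `S` needs no measurable
structure. -/
theorem tdError_eq_add_noise (σ : S → StrategyPair A B) (Q : QTable S A B) (s : S) (a : A) (b : B)
    (ξ : Ω → S → A → B → S) (ω : Ω) :
    tdError G σ Q s a b (ξ ω s a b) = bellman G σ Q s a b - Q s a b +
      ∑ s', G.γ * (stagePayoff (Q s') (σ s') *
        ({ω | ξ ω s a b = s'}.indicator (fun _ => (1 : ℝ)) ω - G.P s a b s')) := by
  classical
  have h : ∑ s', stagePayoff (Q s') (σ s') *
      {ω | ξ ω s a b = s'}.indicator (fun _ => (1 : ℝ)) ω =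
      stagePayoff (Q (ξ ω s a b)) (σ (ξ ω s a b)) := by
    simp [Set.indicator_apply]
  rw [← Finset.mul_sum]
  simp only [mul_sub, Finset.sum_sub_distrib, h, tdError, bellman]
  simp only [mul_comm (G.P s a b _)]
  ring

theorem measurable_stagePayoff_of_measurable {m' : MeasurableSpace Ω} {x : Ω → StrategyPair A B}
    (hx : Measurable x) {U : Ω → A → B → ℝ} (hU : ∀ a b, Measurable fun ω => U ω a b) :
    Measurable fun ω => stagePayoff (U ω) (x ω) :=
  Finset.measurable_fun_sum _ fun a _ => Finset.measurable_fun_sum _ fun b _ =>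
    (((measurable_pi_apply a).comp hx.fst).mul (hU a b)).mul ((measurable_pi_apply b).comp hx.snd)

namespace IsAgentQLearning

variable (h : IsAgentQLearning G μ ℱ ξ α σ Q)

include h

theorem measurable (t : ℕ) (s : S) (a : A) (b : B) : Measurable[ℱ t] fun ω => Q t ω s a b := by
  induction t generalizing s a b with
  | zero =>
    obtain ⟨Q₀, hQ₀⟩ := h.initial
    simp only [hQ₀]
    exact measurable_const
  | succ t ih =>
    have hv := fun s' => (measurable_stagePayoff_of_measurable (h.adapted t s') (ih s')).mono
      (ℱ.mono t.le_succ) le_rfl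
    have hq := (ih s a b).mono (ℱ.mono t.le_succ) le_rfl
    have hI : ∀ s', Measurable[ℱ (t + 1)]
        ({ω | ξ t ω s a b = s'}.indicator fun _ => (1 : ℝ)) := fun s' =>
      measurable_const.indicator (h.sample_measurable t s a b s')
    simp only [h.update, tdError_eq_add_noise, bellman]
    refine hq.add (((((Finset.measurable_fun_sum _ fun s' _ =>
      (hv s').const_mul _).const_mul _).const_add _).sub hq).add
      (Finset.measurable_fun_sum _ fun s' _ =>
        ((hv s').mul ((hI s').sub_const _)).const_mul _) |>.const_mul _)

theorem measurable_stagePayoff (t : ℕ) (s : S) :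
    Measurable[ℱ t] fun ω => stagePayoff (Q t ω s) (σ t ω s) :=
  measurable_stagePayoff_of_measurable (h.adapted t s) (h.measurable t s)

theorem exists_norm_le (hα : RobbinsMonro α) :
    ∃ C, 0 ≤ C ∧ ∀ ω, (∀ t, IsMixed (σ t ω)) → ∀ t, ‖Q t ω‖ ≤ C := by
  obtain ⟨Q₀, hQ₀⟩ := h.initial
  -- Deterministic majorant of the norms; the absolute value covers early rates larger than one.
  let c : ℕ → ℝ := fun t => Nat.rec ‖Q₀‖
    (fun t c => |1 - α t| * c + α t * (‖G.r‖ + G.γ * c)) t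
  have hc0 : ∀ t, 0 ≤ c t := fun t => by
    induction t with
    | zero => exact norm_nonneg _
    | succ t ih =>
      have h1 := hα.1 t
      have h2 := G.γ_nonneg
      change 0 ≤ |1 - α t| * c t + α t * (‖G.r‖ + G.γ * c t)
      positivity
  obtain ⟨C, hC⟩ := hα.exists_bound G.γ_nonneg G.γ_lt_one (c := c) fun t => rfl
  refine ⟨C, (hc0 0).trans (hC 0), fun ω hσ t => le_trans ?_ (hC t)⟩
  induction t with
  | zero => rw [hQ₀]; exact le_rfl
  | succ t ih =>
    refine norm_qTable_le (hc0 (t + 1)) fun s a b => ?_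
    have h1 := hα.1 t
    have h2 := G.γ_nonneg
    have e : Q (t + 1) ω s a b = (1 - α t) * Q t ω s a b + α t * (G.r s a b +
        G.γ * stagePayoff (Q t ω (ξ t ω s a b)) (σ t ω (ξ t ω s a b))) := by
      rw [h.update, tdError]
      ring
    rw [e]
    refine (abs_add_le _ _).trans ?_
    rw [abs_mul, abs_mul, abs_of_nonneg h1]
    refine add_le_add (mul_le_mul_of_nonneg_left ((abs_qTable_apply_le _ _ _ _).trans ih)
      (abs_nonneg _)) (mul_le_mul_of_nonneg_left ((abs_add_le _ _).trans (add_le_add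
        (abs_qTable_apply_le G.r _ _ _) ?_)) h1)
    rw [abs_mul, abs_of_nonneg h2]
    exact mul_le_mul_of_nonneg_left ((abs_stagePayoff_le_norm _ (hσ t) _).trans ih) h2

/-- Q-learning converges to the minimax Q-function if the strategies asymptotically attain the
minimax values of the stage games. -/
theorem ae_tendsto_shapleyQ [Nonempty A] [Nonempty B] [IsProbabilityMeasure μ]
    (hα : RobbinsMonro α) (hσ : ∀ᵐ ω ∂μ, ∀ t, IsMixed (σ t ω))
    (hv : ∀ᵐ ω ∂μ, ∀ s, Tendsto
      (fun t => stagePayoff (Q t ω s) (σ t ω s) - stageValue (Q t ω s)) atTop (𝓝 0)) :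
    ∀ᵐ ω ∂μ, Tendsto (fun t => Q t ω) atTop (𝓝 (shapleyQ G)) := by
  obtain ⟨C, hC0, hC⟩ := h.exists_norm_le hα
  have hnoise : ∀ᵐ ω ∂μ, ∀ s a b s', ∃ l, Tendsto (fun n => ∑ t ∈ Finset.range n,
      α t * (stagePayoff (Q t ω s') (σ t ω s') *
        ({ω | ξ t ω s a b = s'}.indicator (fun _ => (1 : ℝ)) ω - G.P s a b s'))) atTop (𝓝 l) := by
    simp only [ae_all_iff]
    intro s a b s'
    refine ae_exists_tendsto_sum_mul_indicator_sub hα.2.2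
      (fun t => h.sample_measurable t s a b s') (fun t => h.sample_law t s a b s')
      (fun t => h.measurable_stagePayoff t s') hC0 ?_
    filter_upwards [hσ] with ω hω t
    exact (abs_stagePayoff_le_norm _ (hω t) s').trans (hC ω hω t)
  filter_upwards [hσ, hv, hnoise] with ω hω hvω hn
  choose l hl using hn
  refine hα.tendsto_of_contraction G.γ_nonneg G.γ_lt_one (T := shapley G)
    (e := fun t => bellman G (σ t ω) (Q t ω) - shapley G (Q t ω))
    (w := fun t s a b => ∑ s', G.γ * (stagePayoff (Q t ω s') (σ t ω s') *
        ({ω | ξ t ω s a b = s'}.indicator (fun _ => (1 : ℝ)) ω - G.P s a b s')))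
    (l := fun s a b => ∑ s', G.γ * l s a b s')
    (fun x => ?_) (fun t => ?_) ?_ ?_
  · have := norm_shapley_sub_le G x (shapleyQ G)
    rwa [shapley_shapleyQ] at this
  · funext s a b
    rw [h.update, tdError_eq_add_noise]
    simp [mul_add]
  · simp only [tendsto_pi_nhds]
    intro s a b
    have := (tendsto_finsetSum Finset.univ fun s' _ =>
      (hvω s').const_mul (G.P s a b s')).const_mul G.γ
    simpa [bellman, shapley, mul_sub, Finset.sum_sub_distrib] using this
  · simp only [tendsto_pi_nhds]
    intro s a b
    refine (tendsto_finsetSum Finset.univ fun s' _ => (hl s a b s').const_mul G.γ).congr fun n => ?_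
    simp only [Finset.sum_apply, Pi.smul_apply, smul_eq_mul, Finset.mul_sum]
    rw [Finset.sum_comm]
    refine Finset.sum_congr rfl fun t _ => Finset.sum_congr rfl fun s' _ => by ring

end IsAgentQLearning

/-- If both agents use the same mixed strategies and asymptotically equivalent rates, their tables
become equal. -/
theorem IsQLearning.tendsto_sub (h : IsQLearning G μ ℱ ξ αatt αdef σ σ Qatt Qdef)
    (hatt : RobbinsMonro αatt) (hdef : RobbinsMonro αdef) (hα : αatt ~[atTop] αdef) {ω : Ω}
    (hσ : ∀ t, IsMixed (σ t ω)) :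
    Tendsto (fun t => Qatt t ω - Qdef t ω) atTop (𝓝 0) := by
  obtain ⟨C, hC0, hC⟩ := h.attacker.exists_norm_le hatt
  obtain ⟨φ, hφ, hφα⟩ := hα.exists_eq_mul
  have hε : Tendsto (fun t => |φ t - 1| * (‖G.r‖ + G.γ * C + C)) atTop (𝓝 0) := by
    simpa using ((hφ.sub_const 1).abs).mul_const (‖G.r‖ + G.γ * C + C)
  rw [tendsto_zero_iff_norm_tendsto_zero]
  refine hdef.tendsto_zero_of_recursion (sub_pos.2 G.γ_lt_one) (fun t => norm_nonneg _) hε ?_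
  filter_upwards [hφα, hdef.tendsto_zero.eventually_lt_const one_pos] with t ht ht1
  have h1 := hdef.1 t
  have h2 := G.γ_nonneg
  have h3 : 0 ≤ (1 - (1 - G.γ) * αdef t) * ‖Qatt t ω - Qdef t ω‖ :=
    mul_nonneg (by nlinarith) (norm_nonneg _)
  refine norm_qTable_le (by positivity) fun s a b => ?_
  set s' := ξ t ω s a b
  have hdiff : |stagePayoff (Qatt t ω s') (σ t ω s') - stagePayoff (Qdef t ω s') (σ t ω s')| ≤
      ‖Qatt t ω - Qdef t ω‖ := by
    rw [← stagePayoff_sub]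
    exact abs_stagePayoff_le_norm (Qatt t ω - Qdef t ω) (hσ t) s'
  have htd : |tdError G (σ t ω) (Qatt t ω) s a b s'| ≤ ‖G.r‖ + G.γ * C + C := by
    refine (abs_sub _ _).trans (add_le_add ((abs_add_le _ _).trans (add_le_add
      (abs_qTable_apply_le G.r _ _ _) ?_)) ((abs_qTable_apply_le _ _ _ _).trans (hC ω hσ t)))
    rw [abs_mul, abs_of_nonneg h2]
    exact mul_le_mul_of_nonneg_left ((abs_stagePayoff_le_norm _ (hσ t) _).trans (hC ω hσ t)) h2
  -- With `αatt t = φ t * αdef t` and a common next state, the difference contracts at the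
  -- defender's rate; the rate mismatch contributes only the factor `φ t - 1`, which tends to zero.
  have e : (Qatt (t + 1) ω - Qdef (t + 1) ω) s a b =
      (1 - αdef t) * (Qatt t ω - Qdef t ω) s a b + αdef t * (G.γ *
        (stagePayoff (Qatt t ω s') (σ t ω s') - stagePayoff (Qdef t ω s') (σ t ω s'))) +
      αdef t * ((φ t - 1) * tdError G (σ t ω) (Qatt t ω) s a b s') := by
    rw [Pi.mul_apply] at ht
    simp only [Pi.sub_apply, h.update_att, h.update_def, ht, tdError, s']
    ring
  rw [e]
  refine (abs_add_three _ _ _).trans ?_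
  simp only [abs_mul, abs_of_nonneg h1, abs_of_nonneg h2, abs_of_pos (sub_pos.2 ht1)]
  calc _ ≤ (1 - αdef t) * ‖Qatt t ω - Qdef t ω‖ + αdef t * (G.γ * ‖Qatt t ω - Qdef t ω‖) +
        αdef t * (|φ t - 1| * (‖G.r‖ + G.γ * C + C)) := by
        gcongr
        exact abs_qTable_apply_le _ _ _ _
    _ = _ := by ring

end Learning

/-! ### The two modes of play -/

theorem mainTheorem2 {S A B : Type*} [Fintype S] [Fintype A] [Fintype B] [Nonempty A] [Nonempty B]
    (G : MarkovGame S A B)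
    {Ω : Type*} {m : MeasurableSpace Ω} (μ : Measure Ω) [IsProbabilityMeasure μ]
    (ℱ : Filtration ℕ m) (ξ : ℕ → Ω → S → A → B → S) (αatt αdef : ℕ → ℝ)
    (hatt : RobbinsMonro αatt) (hdef : RobbinsMonro αdef)
    (σatt σdef : ℕ → Ω → S → StrategyPair A B) (Qatt Qdef : ℕ → Ω → QTable S A B)
    (hQ : IsQLearning G μ ℱ ξ αatt αdef σatt σdef Qatt Qdef) :
    ∃ Qstar : QTable S A B × QTable S A B,
      (∀ Q, IsNashQEquilibrium G Q ↔ Q = Qstar) ∧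
      -- each agent plays the equilibrium of the stage games of its own Q-estimate
      (PlaysUniqueNash μ Qatt Qatt σatt → PlaysUniqueNash μ Qdef Qdef σdef →
        ∀ᵐ ω ∂μ, Tendsto (fun t => (Qatt t ω, Qdef t ω)) atTop (𝓝 Qstar)) ∧
      -- the agents play the equilibrium of the stage games of the pair of Q-estimates
      (σatt = σdef → PlaysUniqueNash μ Qatt Qdef σatt → αatt ~[atTop] αdef →
        ∀ᵐ ω ∂μ, Tendsto (fun t => (Qatt t ω, Qdef t ω)) atTop (𝓝 Qstar)) := by
  refine ⟨(shapleyQ G, shapleyQ G), isNashQEquilibrium_iff G, ?_, ?_⟩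
  · have own : ∀ {α : ℕ → ℝ} {σ : ℕ → Ω → S → StrategyPair A B} {Q : ℕ → Ω → QTable S A B},
        RobbinsMonro α → IsAgentQLearning G μ ℱ ξ α σ Q → PlaysUniqueNash μ Q Q σ →
        ∀ᵐ ω ∂μ, Tendsto (fun t => Q t ω) atTop (𝓝 (shapleyQ G)) := by
      intro α σ Q hα h hN
      refine h.ae_tendsto_shapleyQ hα ?_ ?_
      · filter_upwards [hN] with ω hω t s
        exact ⟨(hω t s).1.1, (hω t s).1.2.1⟩
      · filter_upwards [hN] with ω hω s
        simp [(hω _ s).1.stagePayoff_eq]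
    intro h1 h2
    filter_upwards [own hatt hQ.attacker h1, own hdef hQ.defender h2] with ω l1 l2
    exact l1.prodMk_nhds l2
  · rintro rfl hN hα
    have hσ : ∀ᵐ ω ∂μ, ∀ t, IsMixed (σatt t ω) := by
      filter_upwards [hN] with ω hω t s
      exact ⟨(hω t s).1.1, (hω t s).1.2.1⟩
    have hD : ∀ᵐ ω ∂μ, Tendsto (fun t => Qatt t ω - Qdef t ω) atTop (𝓝 0) := by
      filter_upwards [hσ] with ω hω
      exact hQ.tendsto_sub hatt hdef hα hω
    -- The defender's table is treated first: its bias is at most `2 * ‖Qatt - Qdef‖`. The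
    -- attacker's limit then follows by adding the vanishing difference.
    have hlim := hQ.defender.ae_tendsto_shapleyQ hdef hσ <| by
      filter_upwards [hN, hD] with ω hω hDω s
      have hb : Tendsto (fun t => 2 * ‖Qatt t ω - Qdef t ω‖) atTop (𝓝 0) := by
        simpa using hDω.norm.const_mul 2
      refine squeeze_zero_norm (fun t => ?_) hb
      have h1 := (hω t s).1.abs_stagePayoff_sub_stageValue_le (Qdef t ω s)
      rw [sub_self, norm_zero, add_zero] at h1
      have h2 := norm_le_pi_norm (Qatt t ω - Qdef t ω) s
      rw [Pi.sub_apply] at h2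
      exact h1.trans (by linarith)
    filter_upwards [hlim, hD] with ω l1 l2
    refine Tendsto.prodMk_nhds ?_ l1
    simpa using l2.add l1
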